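/- Theorem 3.1. For every real number $\alpha>\frac12$ there exist an integer $N_0$ and a constant $C$, both depending only on $\alpha$, such that the following holds for every $n\ge N_0$. Let $G$ be a simple graph with $n$ vertices whose edges are colored with $n$ colors, and let $F_1,\dots,F_n$ be the color classes, so that $F_i$ is the set of edges of color $i$ and $\{F_1,\dots,F_n\}$ is a partition of $E(G)$. Suppose that $\{F_1,\dots,F_n\}=\mathcal F_M\cup\mathcal F_T\cup\mathcal F_S$, where (1) every $F_i\in\mathcal F_M$ is a matching of size 2, that is, consists of two edges with no common vertex; (2) every $F_i\in\mathcal F_T$ is a triangle, that is, consists of the three edges on some three distinct vertices; (3) every $F_i\in\mathcal F_S$ is a single edge; (4) $|\mathcal F_M\cup\mathcal F_T|\ge\alpha n$. Then $G$ contains a rainbow cycle, that is, a cycle whose edges have pairwise distinct colors, of length at most $C\log_2 n$. -/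

import Mathlib

namespace RainbowCycle

variable {V K : Type*} {G : SimpleGraph V}

/-- The color class of the color `i`: the set of all edges of `G` that receive the color `i`. -/
def colorClass (c : G.EdgeLabeling K) (i : K) : Set (Sym2 V) :=
  {e | ∃ he : e ∈ G.edgeSet, c ⟨e, he⟩ = i}

/-- A set of edges is a matching of size 2: it consists of two edges without a common end. -/
def IsMatchingOfSizeTwo (F : Set (Sym2 V)) : Prop :=
  ∃ a b x y : V, [a, b, x, y].Nodup ∧ F = {s(a, b), s(x, y)}

/-- A set of edges is a triangle: it consists of the three edges on three distinct vertices. -/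
def IsTriangle (F : Set (Sym2 V)) : Prop :=
  ∃ a b x : V, [a, b, x].Nodup ∧ F = {s(a, b), s(b, x), s(a, x)}

/-- A set of edges consists of a single edge. -/
def IsSingleEdge (F : Set (Sym2 V)) : Prop :=
  ∃ a b : V, a ≠ b ∧ F = {s(a, b)}

/-- A subgraph is rainbow if its distinct edges have distinct colors. -/
def IsRainbow (c : G.EdgeLabeling K) (H : G.Subgraph) : Prop :=
  Set.InjOn c {e : G.edgeSet | (e : Sym2 V) ∈ H.edgeSet}

end RainbowCycle

/-! Pick one edge of each color so that all of them avoid a set `U` of at least `ε * n` vertices.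
These `n` edges form a rainbow graph on at most `(1 - ε) * n` vertices, and `n > (1 + ε) * (1 - ε) *
n`, so `card_edgesWithin_le` forces a cycle of logarithmic length.

To find `U` (`exists_avoidable`), note that the single edges cover at most `2 * (1 - α) * n`
vertices, leaving at least `(2 * α - 1) * n`, a positive proportion as `α > 1/2`. The color classes
have at most `4 * n` incidences with vertices, so few of these vertices have high degree; a greedy
choice among the others gives a linear-sized `U` meeting each class in at most one vertex. A
2-matching or a triangle always has an edge missing that vertex. -/

namespace RainbowCycle

open Finset

/-! ### Ball growth and short cycles. -/

section ShortCycles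

variable {V : Type*} {H : SimpleGraph V}

/-- An edge together with a walk joining its ends that avoids it yields a cycle. -/
theorem exists_isCycle_of_adj_of_walk {x y : V} (h : H.Adj x y) (p : H.Walk y x)
    (hp : s(x, y) ∉ p.edges) :
    ∃ (v : V) (q : H.Walk v v), q.IsCycle ∧ q.length ≤ p.length + 1 := by
  classical
  refine ⟨x, .cons h p.bypass, ?_, ?_⟩
  · rw [SimpleGraph.Walk.cons_isCycle_iff]
    exact ⟨p.bypass_isPath, fun h' => hp (p.edges_bypass_subset_edges h')⟩
  · simpa using p.length_bypass_le_length

open Classical in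
/-- The ball of radius `k` around `w` in the subgraph of `H` induced on `W`. -/
noncomputable def inducedBall (H : SimpleGraph V) (W : Finset V) (w : V) : ℕ → Finset V
  | 0 => {w}
  | k + 1 => inducedBall H W w k ∪ {x ∈ W | ∃ y ∈ inducedBall H W w k, H.Adj x y}

theorem inducedBall_subset {W : Finset V} {w : V} (hw : w ∈ W) (k : ℕ) :
    inducedBall H W w k ⊆ W := by
  classical
  induction k with
  | zero => simpa [inducedBall] using hw
  | succ k ih => exact union_subset ih (filter_subset _ _)

theorem inducedBall_subset_succ (W : Finset V) (w : V) (k : ℕ) :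
    inducedBall H W w k ⊆ inducedBall H W w (k + 1) := by
  classical
  exact subset_union_left

theorem mem_inducedBall_self (W : Finset V) (w : V) (k : ℕ) : w ∈ inducedBall H W w k := by
  induction k with
  | zero => simp [inducedBall]
  | succ k ih => exact inducedBall_subset_succ W w k ih

/-- A ball has a spanning tree of small depth. -/
theorem exists_spanning_edges_inducedBall (H : SimpleGraph V) (W : Finset V) (w : V) (k : ℕ) :
    ∃ F : Finset (Sym2 V), #F + 1 ≤ #(inducedBall H W w k) ∧
      ∀ x ∈ inducedBall H W w k, ∃ p : H.Walk x w, p.length ≤ k ∧ ∀ e ∈ p.edges, e ∈ F := by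
  classical
  induction k with
  | zero =>
    refine ⟨∅, by simp [inducedBall], fun x hx => ?_⟩
    obtain rfl : x = w := by simpa [inducedBall] using hx
    exact ⟨.nil, by simp, by simp⟩
  | succ k ih =>
    obtain ⟨F, hF, hwalk⟩ := ih
    set B := inducedBall H W w k with hB
    set B' := inducedBall H W w (k + 1) with hB'
    have hnew : ∀ x ∈ B' \ B, ∃ y ∈ B, H.Adj x y := by
      intro x hx
      rw [mem_sdiff] at hx
      have : x ∈ B ∪ {x ∈ W | ∃ y ∈ B, H.Adj x y} := hx.1
      rcases mem_union.1 this with h | h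
      · exact absurd h hx.2
      · exact (mem_filter.1 h).2
    -- Each new vertex costs one edge, to a parent in the previous ball.
    choose! par hpar using hnew
    refine ⟨F ∪ (B' \ B).image fun x => s(x, par x), ?_, fun x hx => ?_⟩
    · have h₁ := card_union_le F ((B' \ B).image fun x => s(x, par x))
      have h₂ : #((B' \ B).image fun x => s(x, par x)) ≤ #(B' \ B) := card_image_le
      have h₃ : #(B' \ B) + #B = #B' :=
        card_sdiff_add_card_eq_card (inducedBall_subset_succ W w k)
      omega
    · by_cases hxB : x ∈ B
      · obtain ⟨p, hp, hpe⟩ := hwalk x hxB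
        exact ⟨p, by omega, fun e he => mem_union_left _ (hpe e he)⟩
      · have hx' : x ∈ B' \ B := mem_sdiff.2 ⟨hx, hxB⟩
        obtain ⟨hy, hadj⟩ := hpar x hx'
        obtain ⟨p, hp, hpe⟩ := hwalk _ hy
        refine ⟨.cons hadj p, by simpa using hp, fun e he => ?_⟩
        rw [SimpleGraph.Walk.edges_cons, List.mem_cons] at he
        rcases he with rfl | he
        · exact mem_union_right _ (mem_image_of_mem _ hx')
        · exact mem_union_left _ (hpe e he)

variable [Fintype V]

open Classical in
/-- The edges of `H` with both ends in `W`. -/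
noncomputable def edgesWithin (H : SimpleGraph V) (W : Finset V) : Finset (Sym2 V) :=
  {e | e ∈ H.edgeSet ∧ ∀ v ∈ e, v ∈ W}

theorem mem_edgesWithin {W : Finset V} {e : Sym2 V} :
    e ∈ edgesWithin H W ↔ e ∈ H.edgeSet ∧ ∀ v ∈ e, v ∈ W := by
  simp [edgesWithin]

/-- Without short cycles, a ball spans fewer edges than it has vertices. -/
theorem card_edgesWithin_inducedBall_le {R k : ℕ} (hk : k ≤ R)
    (hH : ∀ (v : V) (q : H.Walk v v), q.IsCycle → 2 * R + 1 < q.length) (W : Finset V) (w : V) :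
    #(edgesWithin H (inducedBall H W w k)) ≤ #(inducedBall H W w k) := by
  obtain ⟨F, hF, hwalk⟩ := exists_spanning_edges_inducedBall H W w k
  suffices edgesWithin H (inducedBall H W w k) ⊆ F from (card_le_card this).trans (by omega)
  intro e he
  induction e with | _ x y
  by_contra hxyF
  simp only [mem_edgesWithin, SimpleGraph.mem_edgeSet, Sym2.mem_iff, forall_eq_or_imp,
    forall_eq] at he
  obtain ⟨hadj, hx, hy⟩ := he
  obtain ⟨p, hp, hpF⟩ := hwalk x hx
  obtain ⟨q, hq, hqF⟩ := hwalk y hy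
  -- A non-tree edge and the two tree walks to the center close up within length `2 * k + 1`.
  obtain ⟨v, t, ht, hlen⟩ := exists_isCycle_of_adj_of_walk hadj (q.append p.reverse) (by
    rw [SimpleGraph.Walk.edges_append, List.mem_append, SimpleGraph.Walk.edges_reverse,
      List.mem_reverse]
    rintro (h | h)
    exacts [hxyF (hqF _ h), hxyF (hpF _ h)])
  have := hH v t ht
  rw [SimpleGraph.Walk.length_append, SimpleGraph.Walk.length_reverse] at hlen
  omega

/-- Some ball of bounded radius grows slowly. -/
theorem exists_inducedBall_slow_growth {ε : ℝ} (hε : 0 < ε) {R : ℕ}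
    (hR : (Fintype.card V : ℝ) ≤ (1 + ε) ^ R) (W : Finset V) (w : V) :
    ∃ k < R + 1, (#(inducedBall H W w (k + 1)) : ℝ) ≤ (1 + ε) * #(inducedBall H W w k) := by
  by_contra! hgrow
  have key : ∀ k ≤ R + 1, (1 + ε) ^ k ≤ (#(inducedBall H W w k) : ℝ) := by
    intro k hk
    induction k with
    | zero => simp [inducedBall]
    | succ k ih =>
      rw [pow_succ']
      exact (mul_le_mul_of_nonneg_left (ih (by omega)) (by positivity)).trans
        (hgrow k (by omega)).le
  have h₁ := key (R + 1) le_rfl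
  have h₂ : (#(inducedBall H W w (R + 1)) : ℝ) ≤ Fintype.card V := by
    exact_mod_cast card_le_univ _
  have h₃ : (1 + ε) ^ R < (1 + ε) ^ (R + 1) := pow_lt_pow_right₀ (by linarith) (by omega)
  linarith

/-- An edge of `W` touching a ball has both ends in the next ball. -/
theorem card_edgesWithin_le_sdiff_add (W : Finset V) (w : V) (k : ℕ) [DecidableEq V] :
    #(edgesWithin H W) ≤ #(edgesWithin H (W \ inducedBall H W w k)) +
      #(edgesWithin H (inducedBall H W w (k + 1))) := by
  classical
  refine (card_le_card fun e he => ?_).trans (card_union_le _ _)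
  induction e with | _ x y
  simp only [mem_edgesWithin, inducedBall, mem_union, mem_filter, SimpleGraph.mem_edgeSet, Sym2.mem_iff, forall_eq_or_imp, forall_eq, mem_sdiff] at he ⊢
  obtain ⟨hadj, hx, hy⟩ := he
  by_cases hxB : x ∈ inducedBall H W w k
  · exact .inr ⟨hadj, .inl hxB, .inr ⟨hy, x, hxB, hadj.symm⟩⟩
  by_cases hyB : y ∈ inducedBall H W w k
  · exact .inr ⟨hadj, .inr ⟨hx, y, hyB, hadj⟩, .inl hyB⟩
  · exact .inl ⟨hadj, ⟨hx, hxB⟩, hy, hyB⟩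

/-- A graph without cycles of logarithmic length has few edges. -/
theorem card_edgesWithin_le {ε : ℝ} (hε : 0 < ε) {R : ℕ}
    (hR : (Fintype.card V : ℝ) ≤ (1 + ε) ^ R)
    (hH : ∀ (v : V) (q : H.Walk v v), q.IsCycle → 2 * (R + 1) + 1 < q.length) (W : Finset V) :
    (#(edgesWithin H W) : ℝ) ≤ (1 + ε) * #W := by
  classical
  induction W using Finset.strongInduction with
  | H W ih =>
    obtain rfl | ⟨w, hw⟩ := W.eq_empty_or_nonempty
    · have : edgesWithin H (∅ : Finset V) = ∅ := by
        refine eq_empty_of_forall_notMem fun e he => ?_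
        induction e with | _ x y
        simpa using (mem_edgesWithin.1 he).2 x (Sym2.mem_mk_left x y)
      simp [this]
    -- Delete a slowly growing ball: the edges lost lie in the next ball, hence number at most `1 +
    -- ε` per deleted vertex. That next ball may have radius `R + 1`, whence the bound in `hH`.
    obtain ⟨k, hk, hslow⟩ := exists_inducedBall_slow_growth (H := H) hε hR W w
    have hBW := inducedBall_subset (H := H) hw k
    have h₁ := ih (W \ inducedBall H W w k)
      (sdiff_ssubset hBW ⟨w, mem_inducedBall_self W w k⟩)
    have h₂ : (#(edgesWithin H W) : ℝ) ≤ #(edgesWithin H (W \ inducedBall H W w k)) +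
        #(edgesWithin H (inducedBall H W w (k + 1))) := by
      exact_mod_cast card_edgesWithin_le_sdiff_add W w k
    have h₃ : (#(edgesWithin H (inducedBall H W w (k + 1))) : ℝ) ≤
        #(inducedBall H W w (k + 1)) := by
      exact_mod_cast card_edgesWithin_inducedBall_le (by omega) hH W w
    have h₄ : (#(W \ inducedBall H W w k) : ℝ) + #(inducedBall H W w k) = #W := by
      exact_mod_cast card_sdiff_add_card_eq_card hBW
    rw [← h₄, mul_add]
    linarith

end ShortCycles

/-! ### Strongly independent sets. -/

section Transversal

variable {V ι : Type*} [DecidableEq V] [Fintype ι]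

/-- Among points of low degree in a hypergraph with bounded edges there is a large set that is
strongly independent. -/
theorem exists_strongly_independent (A : ι → Finset V) (L : Finset V) {a D : ℕ}
    (hA : ∀ i, #(A i) ≤ a) (hL : ∀ v ∈ L, #{i | v ∈ A i} ≤ D) :
    ∃ U ⊆ L, #L ≤ #U * (a * D + 1) ∧
      ∀ i, ∀ u ∈ U, ∀ v ∈ U, u ∈ A i → v ∈ A i → u = v := by
  classical
  let P := L.powerset.filter fun U => ∀ i, ∀ u ∈ U, ∀ v ∈ U, u ∈ A i → v ∈ A i → u = v
  have hP : ∀ U, U ∈ P ↔ U ⊆ L ∧ ∀ i, ∀ u ∈ U, ∀ v ∈ U, u ∈ A i → v ∈ A i → u = v := by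
    simp [P]
  obtain ⟨U, hU, hmax⟩ := exists_max_image P card ⟨∅, by simp [P]⟩
  obtain ⟨hUL, hind⟩ := (hP U).1 hU
  refine ⟨U, hUL, ?_, hind⟩
  -- By maximality of `U`, every point of `L` is in `U` or shares some `A i` with a point of `U`.
  have hcover : L ⊆ U.biUnion fun u => insert u (({i | u ∈ A i} : Finset ι).biUnion A) := by
    intro v hv
    rw [mem_biUnion]
    by_contra! hfar
    have hvU : v ∉ U := fun h => hfar v h (mem_insert_self _ _)
    have hsep : ∀ i, ∀ u ∈ U, u ∈ A i → v ∉ A i := fun i u hu hi hvi =>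
      hfar u hu (mem_insert_of_mem (mem_biUnion.2 ⟨i, by simpa using hi, hvi⟩))
    have hmem : insert v U ∈ P := by
      refine (hP _).2 ⟨insert_subset hv hUL, fun i x hx y hy hxi hyi => ?_⟩
      rcases mem_insert.1 hx with rfl | hxU <;> rcases mem_insert.1 hy with rfl | hyU
      · rfl
      · exact absurd hxi (hsep i y hyU hyi)
      · exact absurd hyi (hsep i x hxU hxi)
      · exact hind i x hxU y hyU hxi hyi
    have := hmax _ hmem
    rw [card_insert_of_notMem hvU] at this
    omega
  refine (card_le_card hcover).trans (card_biUnion_le_card_mul _ _ _ fun u hu => ?_)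
  refine (card_insert_le _ _).trans (Nat.add_le_add_right ?_ 1)
  calc #(({i | u ∈ A i} : Finset ι).biUnion A) ≤ #{i | u ∈ A i} * a :=
        card_biUnion_le_card_mul _ _ _ fun i _ => hA i
    _ ≤ a * D := by rw [mul_comm]; exact Nat.mul_le_mul_left a (hL u (hUL hu))

/-- A large set of points contains a large strongly independent subset. -/
theorem exists_large_strongly_independent [Fintype V] (A : ι → Finset V) (B : Finset V) {a : ℕ}
    (hA : ∀ i, #(A i) ≤ a) (D : ℕ) :
    ∃ U ⊆ B, D * #B ≤ a * Fintype.card ι + D * (#U * (a * D + 1)) ∧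
      ∀ i, ∀ u ∈ U, ∀ v ∈ U, u ∈ A i → v ∈ A i → u = v := by
  classical
  set L := {v ∈ B | #{i | v ∈ A i} ≤ D} with hLdef
  obtain ⟨U, hUL, hcard, hind⟩ := exists_strongly_independent A L hA
    (fun v hv => (mem_filter.1 hv).2)
  refine ⟨U, hUL.trans (filter_subset _ _), ?_, hind⟩
  -- Points of degree above `D` are few, by double counting incidences.
  set L' := {v ∈ B | ¬ #{i | v ∈ A i} ≤ D} with hL'def
  have hsplit : #L + #L' = #B := card_filter_add_card_filter_not _
  have h₁ : #L' * D ≤ ∑ v ∈ L', #{i | v ∈ A i} := by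
    rw [← smul_eq_mul]
    exact card_nsmul_le_sum _ _ _ fun v hv => (not_le.1 (mem_filter.1 hv).2).le
  have h₂ : ∑ v ∈ L', #{i | v ∈ A i} ≤ ∑ v : V, #{i | v ∈ A i} :=
    sum_le_sum_of_subset (subset_univ _)
  have h₃ : ∑ v : V, #{i | v ∈ A i} = ∑ i, #(A i) := by
    have := sum_card_bipartiteAbove_eq_sum_card_bipartiteBelow
      (s := (univ : Finset V)) (t := (univ : Finset ι)) (fun v i => v ∈ A i)
    simpa [bipartiteAbove, bipartiteBelow] using this
  have h₄ : ∑ i, #(A i) ≤ Fintype.card ι * a := by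
    simpa using sum_le_card_nsmul univ (fun i => #(A i)) a fun i _ => hA i
  have h₅ := Nat.mul_le_mul_left D hcard
  calc D * #B = D * #L + #L' * D := by rw [← hsplit]; ring
    _ ≤ _ := by linarith

end Transversal

/-! ### Color classes and rainbow transversals. -/

section ColorClasses

variable {V K : Type*} {G : SimpleGraph V}

open Classical in
/-- The set of ends of the edges in `F`. -/
noncomputable def ends [Fintype V] (F : Set (Sym2 V)) : Finset V :=
  {v | ∃ e ∈ F, v ∈ e}

theorem mem_ends [Fintype V] {F : Set (Sym2 V)} {v : V} : v ∈ ends F ↔ ∃ e ∈ F, v ∈ e := by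
  simp [ends]

theorem IsMatchingOfSizeTwo.card_ends_le [Fintype V] {F : Set (Sym2 V)}
    (h : IsMatchingOfSizeTwo F) : #(ends F) ≤ 4 := by
  classical
  obtain ⟨a, b, x, y, -, rfl⟩ := h
  refine (card_le_card (t := {a, b, x, y}) fun v hv => ?_).trans card_le_four
  simp only [mem_ends, Set.mem_insert_iff, Set.mem_singleton_iff, exists_eq_or_imp,
    exists_eq_left, Sym2.mem_iff] at hv
  simp only [mem_insert, mem_singleton]
  tauto

theorem IsTriangle.card_ends_le [Fintype V] {F : Set (Sym2 V)}
    (h : IsTriangle F) : #(ends F) ≤ 3 := by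
  classical
  obtain ⟨a, b, x, -, rfl⟩ := h
  refine (card_le_card (t := {a, b, x}) fun v hv => ?_).trans card_le_three
  simp only [mem_ends, Set.mem_insert_iff, Set.mem_singleton_iff, exists_eq_or_imp,
    exists_eq_left, Sym2.mem_iff] at hv
  simp only [mem_insert, mem_singleton]
  tauto

theorem IsSingleEdge.card_ends_le [Fintype V] {F : Set (Sym2 V)}
    (h : IsSingleEdge F) : #(ends F) ≤ 2 := by
  classical
  obtain ⟨a, b, -, rfl⟩ := h
  refine (card_le_card (t := {a, b}) fun v hv => ?_).trans card_le_two
  simpa [mem_ends] using hv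

/-- This property, shared with triangles, is what fails for single edges. -/
theorem IsMatchingOfSizeTwo.exists_mem_notMem {F : Set (Sym2 V)} (h : IsMatchingOfSizeTwo F)
    (u : V) : ∃ e ∈ F, u ∉ e := by
  obtain ⟨a, b, x, y, hnd, rfl⟩ := h
  simp only [List.nodup_cons, List.mem_cons, List.not_mem_nil] at hnd
  by_cases hu : u ∈ s(a, b)
  · refine ⟨s(x, y), by simp, fun hu' => ?_⟩
    rw [Sym2.mem_iff] at hu hu'
    rcases hu with rfl | rfl <;> rcases hu' with rfl | rfl <;> simp at hnd
  · exact ⟨s(a, b), by simp, hu⟩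

theorem IsTriangle.exists_mem_notMem {F : Set (Sym2 V)} (h : IsTriangle F)
    (u : V) : ∃ e ∈ F, u ∉ e := by
  obtain ⟨a, b, x, hnd, rfl⟩ := h
  simp only [List.nodup_cons, List.mem_cons, List.not_mem_nil] at hnd
  by_cases hu : u ∈ s(a, b)
  · by_cases hua : u = a
    · refine ⟨s(b, x), by simp, fun hu' => ?_⟩
      rw [Sym2.mem_iff] at hu'
      grind
    · refine ⟨s(a, x), by simp, fun hu' => ?_⟩
      rw [Sym2.mem_iff] at hu hu'
      grind
  · exact ⟨s(a, b), by simp, hu⟩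

/-- If a set meets the ends of `F` in at most one point, and every point is avoided by an edge of
`F`, then an edge of `F` avoids the set. -/
theorem exists_mem_forall_notMem [Fintype V] [Nonempty V] {F : Set (Sym2 V)} {U : Finset V}
    (hF : ∀ u : V, ∃ e ∈ F, u ∉ e)
    (hU : ∀ u ∈ U, ∀ v ∈ U, u ∈ ends F → v ∈ ends F → u = v) :
    ∃ e ∈ F, ∀ v ∈ e, v ∉ U := by
  by_cases h : ∃ u ∈ U, u ∈ ends F
  · obtain ⟨u, huU, huF⟩ := h
    obtain ⟨e, he, hue⟩ := hF u
    exact ⟨e, he, fun v hv hvU => hue (hU u huU v hvU huF (mem_ends.2 ⟨e, he, hv⟩) ▸ hv)⟩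
  · push Not at h
    obtain ⟨e, he, -⟩ := hF (Classical.arbitrary V)
    exact ⟨e, he, fun v hv hvU => h v hvU (mem_ends.2 ⟨e, he, hv⟩)⟩

/-- Choosing an edge of every color inside `W` gives a short rainbow cycle as soon as there are
more colors than `W` can support. -/
theorem exists_rainbow_isCycle [Fintype V] [Fintype K] (c : G.EdgeLabeling K) (W : Finset V)
    (hW : ∀ i, ∃ e ∈ colorClass c i, ∀ v ∈ e, v ∈ W) {ε : ℝ} (hε : 0 < ε) {R : ℕ}
    (hR : (Fintype.card V : ℝ) ≤ (1 + ε) ^ R) (hcard : (1 + ε) * #W < Fintype.card K) :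
    ∃ (v : V) (p : G.Walk v v), p.IsCycle ∧ IsRainbow c p.toSubgraph ∧
      p.length ≤ 2 * (R + 1) + 1 := by
  classical
  choose f hfc hfW using hW
  have hcolor : ∀ i (h : f i ∈ G.edgeSet), c ⟨f i, h⟩ = i := fun i _ => (hfc i).2
  have hinj : Function.Injective f := by
    intro i j hij
    obtain ⟨h, hi⟩ := hfc i
    rw [← hi, ← hcolor j (hij ▸ h)]
    congr 2
  -- With one edge per color, every cycle of `H` is rainbow in `G`.
  let H := SimpleGraph.fromEdgeSet (Set.range f)
  have hHG : H ≤ G := by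
    intro x y hxy
    obtain ⟨⟨i, hi⟩, -⟩ := (SimpleGraph.fromEdgeSet_adj _).1 hxy
    rw [← SimpleGraph.mem_edgeSet, ← hi]
    exact (hfc i).1
  have hedge : ∀ i, f i ∈ edgesWithin H W := by
    intro i
    refine mem_edgesWithin.2 ⟨?_, hfW i⟩
    rw [SimpleGraph.edgeSet_fromEdgeSet]
    exact ⟨⟨i, rfl⟩, G.not_isDiag_of_mem_edgeSet (hfc i).1⟩
  have hmany : Fintype.card K ≤ #(edgesWithin H W) := by
    rw [← card_univ, ← card_image_of_injective univ hinj]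
    exact card_le_card fun e he => by
      obtain ⟨i, -, rfl⟩ := mem_image.1 he
      exact hedge i
  by_contra! hno
  have hfew := card_edgesWithin_le hε hR (H := H) (fun v q hq => ?_) W
  · have : (Fintype.card K : ℝ) ≤ #(edgesWithin H W) := by exact_mod_cast hmany
    linarith
  refine (hno v (q.mapLe hHG) (hq.mapLe hHG) ?_).trans_eq (by simp)
  have hrange : ∀ e ∈ (q.mapLe hHG).toSubgraph.edgeSet, ∃ i, f i = e := by
    intro e he
    rw [SimpleGraph.Walk.mem_edges_toSubgraph, SimpleGraph.Walk.edges_mapLe_eq_edges] at he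
    have := q.edges_subset_edgeSet he
    rw [SimpleGraph.edgeSet_fromEdgeSet] at this
    exact this.1
  rintro ⟨e, he⟩ heq ⟨e', he'⟩ heq' hcc
  obtain ⟨i, rfl⟩ := hrange e heq
  obtain ⟨j, rfl⟩ := hrange e' heq'
  rw [hcolor, hcolor] at hcc
  subst hcc
  rfl

end ColorClasses

/-! ### Choice of parameters and conclusion. -/

/-- The radius of the balls is at most logarithmic. -/
theorem exists_pow_ge_of_log {ε : ℝ} (hε : 0 < ε) {n : ℕ} (hn : 2 ≤ n) :
    ∃ R : ℕ, (n : ℝ) ≤ (1 + ε) ^ R ∧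
      ((2 * (R + 1) + 1 : ℕ) : ℝ) ≤ (2 * Real.logb (1 + ε) 2 + 5) * Real.logb 2 n := by
  have hn0 : (0 : ℝ) < n := by exact_mod_cast (by omega : 0 < n)
  -- This lets the additive constant 5 be absorbed into the factor of `Real.logb 2 n`.
  have hlog : 1 ≤ Real.logb 2 n := by
    rw [Real.le_logb_iff_rpow_le one_lt_two hn0]
    simpa using (by exact_mod_cast hn : (2 : ℝ) ≤ n)
  have hmul : Real.logb (1 + ε) 2 * Real.logb 2 n = Real.logb (1 + ε) n :=
    Real.mul_logb (by norm_num) (by norm_num) (by norm_num)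
  have hnonneg : 0 ≤ Real.logb (1 + ε) n :=
    Real.logb_nonneg (by linarith) (by exact_mod_cast (by omega : 1 ≤ n))
  refine ⟨⌈Real.logb (1 + ε) n⌉₊, ?_, ?_⟩
  · rw [← Real.rpow_natCast, ← Real.logb_le_iff_le_rpow (by linarith) hn0]
    exact Nat.le_ceil _
  · have := Nat.ceil_lt_add_one hnonneg
    push_cast
    rw [add_mul, mul_assoc, hmul]
    linarith

/-- A set of vertices of linear size that can be avoided by an edge of every color. -/
theorem exists_avoidable {V : Type*} [Fintype V] {G : SimpleGraph V} {n : ℕ} (hn : 0 < n)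
    (c : G.EdgeLabeling (Fin n)) (M T S : Finset (Fin n)) (hV : Fintype.card V = n)
    (hun : M ∪ T ∪ S = univ)
    (hM : ∀ i ∈ M, IsMatchingOfSizeTwo (colorClass c i))
    (hT : ∀ i ∈ T, IsTriangle (colorClass c i))
    (hS : ∀ i ∈ S, IsSingleEdge (colorClass c i)) (D : ℕ) :
    ∃ U : Finset V, D * (2 * #(M ∪ T)) ≤ (4 + D) * n + D * (#U * (4 * D + 1)) ∧
      ∀ i, ∃ e ∈ colorClass c i, ∀ v ∈ e, v ∉ U := by
  classical
  have : Nonempty V := Fintype.card_pos_iff.1 (by omega)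
  have hS' : ∀ i ∉ M ∪ T, IsSingleEdge (colorClass c i) := fun i hi => by
    have : i ∈ M ∪ T ∪ S := hun ▸ mem_univ i
    exact hS i ((mem_union.1 this).resolve_left hi)
  let A : Fin n → Finset V := fun i => ends (colorClass c i)
  have hA : ∀ i, #(A i) ≤ 4 := fun i => by
    by_cases hi : i ∈ M ∪ T
    · rcases mem_union.1 hi with h | h
      · exact (hM i h).card_ends_le
      · exact (hT i h).card_ends_le.trans (by norm_num)
    · exact (hS' i hi).card_ends_le.trans (by norm_num)
  -- `U` is sought off the ends of the single edges, so that those edges avoid it automatically.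
  let E := (M ∪ T)ᶜ.biUnion A
  obtain ⟨U, hUB, hcard, hind⟩ := exists_large_strongly_independent A Eᶜ hA D
  refine ⟨U, ?_, fun i => ?_⟩
  · have h₁ : #E ≤ #(M ∪ T)ᶜ * 2 :=
      card_biUnion_le_card_mul _ _ _ fun i hi => (hS' i (mem_compl.1 hi)).card_ends_le
    have h₂ : #(M ∪ T) + #(M ∪ T)ᶜ = n := by
      rw [card_add_card_compl, Fintype.card_fin]
    have h₃ : #E + #Eᶜ = n := by rw [card_add_card_compl, hV]
    rw [Fintype.card_fin] at hcard
    have h₄ : 2 * #(M ∪ T) ≤ n + #Eᶜ := by omega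
    have h₅ := Nat.mul_le_mul_left D h₄
    linarith
  · by_cases hi : i ∈ M ∪ T
    · refine exists_mem_forall_notMem (fun u => ?_) (hind i)
      rcases mem_union.1 hi with h | h
      · exact (hM i h).exists_mem_notMem u
      · exact (hT i h).exists_mem_notMem u
    · obtain ⟨a, b, -, hab⟩ := hS' i hi
      refine ⟨s(a, b), by simp [hab], fun v hv hvU => ?_⟩
      refine mem_compl.1 (hUB hvU) (mem_biUnion.2 ⟨i, mem_compl.2 hi, ?_⟩)
      exact mem_ends.2 ⟨s(a, b), by simp [hab], hv⟩

end RainbowCycle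

theorem theorem3p1 (α : ℝ) (hα : 1 / 2 < α) :
    ∃ (N₀ : ℕ) (C : ℝ), ∀ (n : ℕ), N₀ ≤ n →
      ∀ (V : Type*) [Fintype V] (G : SimpleGraph V) (c : G.EdgeLabeling (Fin n))
        (M T S : Finset (Fin n)),
        Fintype.card V = n →
        M ∪ T ∪ S = Finset.univ →
        (∀ i ∈ M, RainbowCycle.IsMatchingOfSizeTwo (RainbowCycle.colorClass c i)) →
        (∀ i ∈ T, RainbowCycle.IsTriangle (RainbowCycle.colorClass c i)) →
        (∀ i ∈ S, RainbowCycle.IsSingleEdge (RainbowCycle.colorClass c i)) →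
        α * (n : ℝ) ≤ ((M ∪ T).card : ℝ) →
        ∃ (v : V) (p : G.Walk v v), p.IsCycle ∧ RainbowCycle.IsRainbow c p.toSubgraph ∧
          (p.length : ℝ) ≤ C * Real.logb 2 (n : ℝ) := by
  classical
  -- The 8 makes the loss `4 * n / D` to high degrees less than half of `(2 * α - 1) * n`; the
  -- greedy choice then divides the other half by `4 * D + 1`, which gives `ε`.
  obtain ⟨D, hD⟩ := exists_nat_gt (8 / (2 * α - 1))
  have hδ : 0 < 2 * α - 1 := by linarith
  have hDpos : (0 : ℝ) < D := (by positivity : (0 : ℝ) < 8 / (2 * α - 1)).trans hD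
  rw [div_lt_iff₀ hδ] at hD
  set ε : ℝ := (2 * α - 1) / (2 * (4 * D + 1)) with hεdef
  have hε : 0 < ε := by positivity
  refine ⟨2, 2 * Real.logb (1 + ε) 2 + 5, ?_⟩
  intro n hn V _ G c M T S hV hun hM hT hS hα'
  have hn0 : (0 : ℝ) < n := by exact_mod_cast (by omega : 0 < n)
  obtain ⟨U, hU, hav⟩ := RainbowCycle.exists_avoidable (by omega) c M T S hV hun hM hT hS D
  have hUlarge : ε * n ≤ U.card := by
    have h₁ : (D : ℝ) * (2 * (M ∪ T).card) ≤ (4 + D) * n + D * (U.card * (4 * D + 1)) := by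
      exact_mod_cast hU
    have h₂ := mul_le_mul_of_nonneg_left hα' hDpos.le
    have h₃ := mul_lt_mul_of_pos_right hD hn0
    have h₄ : (D : ℝ) * ((2 * α - 1) * n) ≤ D * (2 * (U.card * (4 * D + 1))) := by linarith
    have h₅ := le_of_mul_le_mul_left h₄ hDpos
    rw [hεdef, div_mul_eq_mul_div, div_le_iff₀ (by positivity)]
    linarith
  obtain ⟨R, hR, hlen⟩ := RainbowCycle.exists_pow_ge_of_log hε hn
  have hUc : (U.card : ℝ) + (Uᶜ.card : ℝ) = n := by
    exact_mod_cast hV ▸ Finset.card_add_card_compl U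
  obtain ⟨v, p, hp, hrain, hpl⟩ := RainbowCycle.exists_rainbow_isCycle c Uᶜ
    (fun i => by simpa using hav i) hε (R := R) (by rwa [hV]) (by
      rw [Fintype.card_fin]
      have h₁ : (Uᶜ.card : ℝ) ≤ (1 - ε) * n := by linarith
      have h₂ := mul_le_mul_of_nonneg_left h₁ (by positivity : 0 ≤ 1 + ε)
      have h₃ : 0 < ε * ε * n := by positivity
      linarith)
  exact ⟨v, p, hp, hrain, le_trans (by exact_mod_cast hpl) hlen⟩
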